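/- Let $N\ge 2$ and let players $i=1,\dots,N$ have scalar actions $x_i\in\mathbb R$ and cost functions $f_i:\mathbb R^N\to\mathbb R$. An action profile $\mathbf x^*$ is a Nash equilibrium if, for every $i$, $f_i(x_i^*,\mathbf x_{-i}^*)\le f_i(x_i,\mathbf x_{-i}^*)$ for all $x_i\in\mathbb R$. Assume: (a) each $f_i$ is twice continuously differentiable, and each $\frac{\partial f_i}{\partial x_i}:\mathbb R^N\to\mathbb R$ is globally Lipschitz; (b) with $\Upsilon(\mathbf x)=\big(\frac{\partial f_1}{\partial x_1}(\mathbf x),\dots,\frac{\partial f_N}{\partial x_N}(\mathbf x)\big)^T$, there is $m>0$ such that $(\mathbf x-\mathbf z)^T(\Upsilon(\mathbf x)-\Upsilon(\mathbf z))\ge m\|\mathbf x-\mathbf z\|^2$ for all $\mathbf x,\mathbf z\in\mathbb R^N$; (c) $(a_{ij})$ is the adjacency matrix of an undirected connected weighted graph on the players, that is, $a_{ij}=a_{ji}\ge 0$, $a_{ii}=0$, and the graph with an edge between $i$ and $j$ whenever $a_{ij}>0$ is connected; (d) the disturbances $d_i$ are continuously differentiable on $[t_0,\infty)$ with $\dot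 d_i$ bounded there. Fix positive constants $\bar\theta_{ij},k_{i1},k_{i2}$. For gains $\theta,\sigma>0$ consider, for $t\ge t_0$, the closed-loop system $$\dot x_i=u_i+d_i(t),\qquad u_i=-\frac{\partial f_i}{\partial x_i}(\mathbf y_i)-\hat z_i,\qquad \mathbf y_i=(y_{i1},\dots,y_{iN})^T,$$ $$\dot y_{ij}=-\theta\bar\theta_{ij}\Big(\sum_{k=1}^N a_{ik}(y_{ij}-y_{kj})+a_{ij}(y_{ij}-x_j)\Big),$$ $$\dot{\hat x}_i=u_i+\hat z_i+\sigma k_{i1}(x_i-\hat x_i),\qquad \dot{\hat z}_i=\sigma^2k_{i2}(x_i-\hat x_i).$$ Then the game has exactly one Nash equilibrium $\mathbf x^*$. Let $\mathcal E(t)$ be the vector with entries $x_i-\hat x_i$, $d_i(t)-\hat z_i$, $y_{ij}-x_j$ and $x_i-x_i^*$ $(1\le i,j\le N)$, and let $\|\cdot\|$ be the Euclidean norm. There is a constant $\theta^*>0$ such that for every $v_1>0$ there is a constant $\sigma^*=\sigma^*(v_1)>0$ such that for all $\theta\in(\theta^*,\infty)$ and $\sigma\in(\sigma^*,\infty)$: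 for every initial condition at $t_0$ the closed-loop system has a solution on $[t_0,\infty)$, and for every solution on $[t_0,\infty)$ (whatever its initial condition) there is $\bar T\ge t_0$ such that $\|\mathcal E(t)\|\le v_1$ for all $t\ge\bar T$. -/

import Mathlib

open scoped NNReal

noncomputable section

namespace NashSeeking

/-- Action profiles of `N` players with scalar actions: `ℝ^N` with the Euclidean norm. -/
abbrev Profile (N : ℕ) := EuclideanSpace ℝ (Fin N)

/-- The partial derivative `∂g/∂x_i` at `x`. -/
def partialDeriv {N : ℕ} (g : Profile N → ℝ) (i : Fin N) (x : Profile N) : ℝ :=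
  fderiv ℝ g x (EuclideanSpace.single i 1)

/-- The pseudo-gradient `Υ(x) = [∂f_i/∂x_i (x)]_vec`. -/
def pseudoGradient {N : ℕ} (f : Fin N → Profile N → ℝ) (x : Profile N) : Profile N :=
  WithLp.toLp 2 fun i => partialDeriv (f i) i x

/-- Strong monotonicity of the pseudo-gradient, with some constant `m > 0`. -/
def StronglyMonotone {N : ℕ} (f : Fin N → Profile N → ℝ) : Prop :=
  ∃ m : ℝ, 0 < m ∧ ∀ x z : Profile N,
    m * ‖x - z‖ ^ 2 ≤ inner ℝ (x - z) (pseudoGradient f x - pseudoGradient f z)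

/-- Nash equilibrium: no player lowers its own cost by a unilateral change of its action. -/
def IsNashEquilibrium {N : ℕ} (f : Fin N → Profile N → ℝ) (xs : Profile N) : Prop :=
  ∀ (i : Fin N) (s : ℝ), f i xs ≤ f i (WithLp.toLp 2 (Function.update (fun j => xs j) i s))

/-- `a` is the adjacency matrix of an undirected, connected weighted graph without loops. -/
structure IsUndirectedConnected {N : ℕ} (a : Matrix (Fin N) (Fin N) ℝ) : Prop where
  nonneg : ∀ i j, 0 ≤ a i j
  diag : ∀ i, a i i = 0
  symm : ∀ i j, a i j = a j i
  connected : (SimpleGraph.fromRel fun i j => 0 < a i j).Connected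

/-- The disturbance is continuously differentiable, with bounded derivative, on `[t₀, ∞)`. -/
structure IsAdmissibleDisturbance {N : ℕ} (t₀ : ℝ) (d : Fin N → ℝ → ℝ) : Prop where
  contDiffOn : ∀ i, ContDiffOn ℝ 1 (d i) (Set.Ici t₀)
  bounded : ∀ i, ∃ D : ℝ, ∀ t, t₀ ≤ t → |derivWithin (d i) (Set.Ici t₀) t| ≤ D

/-- The value of the closed-loop state: the actions `x`, the estimates `y i` of all the actions
held by player `i`, and the states `xhat`, `zhat` of the observers. -/
structure State (N : ℕ) where
  x : Profile N
  y : Fin N → Profile N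
  xhat : Profile N
  zhat : Profile N

/-- The control input `u_i = -∂f_i/∂x_i (y_i) - ẑ_i`. -/
def controlInput {N : ℕ} (f : Fin N → Profile N → ℝ) (S : State N) (i : Fin N) : ℝ :=
  -partialDeriv (f i) i (S.y i) - S.zhat i

/-- `S` solves the closed-loop system on `[t₀, ∞)` with gains `θ_ij = θ * θbar i j`,
`σ * k₁ i` and `σ² * k₂ i` (one-sided derivatives at `t₀`). -/
structure IsClosedLoopSolution {N : ℕ} (f : Fin N → Profile N → ℝ)
    (a : Matrix (Fin N) (Fin N) ℝ) (θbar : Fin N → Fin N → ℝ) (k₁ k₂ : Fin N → ℝ)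
    (d : Fin N → ℝ → ℝ) (t₀ θ σ : ℝ) (S : ℝ → State N) : Prop where
  x_deriv : ∀ i t, t₀ ≤ t → HasDerivWithinAt (fun s => (S s).x i)
    (controlInput f (S t) i + d i t) (Set.Ici t₀) t
  y_deriv : ∀ i j t, t₀ ≤ t → HasDerivWithinAt (fun s => (S s).y i j)
    (-(θ * θbar i j) * ((∑ k, a i k * ((S t).y i j - (S t).y k j))
      + a i j * ((S t).y i j - (S t).x j))) (Set.Ici t₀) t
  xhat_deriv : ∀ i t, t₀ ≤ t → HasDerivWithinAt (fun s => (S s).xhat i)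
    (controlInput f (S t) i + (S t).zhat i + σ * k₁ i * ((S t).x i - (S t).xhat i))
    (Set.Ici t₀) t
  zhat_deriv : ∀ i t, t₀ ≤ t → HasDerivWithinAt (fun s => (S s).zhat i)
    (σ ^ 2 * k₂ i * ((S t).x i - (S t).xhat i)) (Set.Ici t₀) t

/-- The total error `[ζ₁, ζ₂, η, ξ]`, where `ζ₁ = x - x̂`, `ζ₂ = d(t) - ẑ`,
`η_ij = y_ij - x_j` and `ξ = x - x*`, as a vector with the Euclidean norm. -/
def totalError {N : ℕ} (xs : Profile N) (d : Fin N → ℝ → ℝ) (t : ℝ) (S : State N) :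
    EuclideanSpace ℝ (Fin N ⊕ Fin N ⊕ (Fin N × Fin N) ⊕ Fin N) :=
  WithLp.toLp 2 (Sum.elim (fun i => S.x i - S.xhat i)
    (Sum.elim (fun i => d i t - S.zhat i)
      (Sum.elim (fun p => S.y p.1 p.2 - S.x p.2) (fun i => S.x i - xs i))))

end NashSeeking

end

/-! The closed loop is a cascade. Subtracting the observer from the plant cancels `u_i`, so with `ζ₁
= x - x̂`, `ζ₂ = d - ẑ` each player's observer error obeys a linear planar system driven only by the
bounded `ḋ_i`. After rescaling `ζ₁` by `σ`, its decay rate is of order `σ`, and a quadratic Lyapunov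
function makes the errors ultimately as small as desired for large `σ` (`exists_gain_observer`).

The remaining dynamics are `ẋ_i = -∂f_i/∂x_i(y_i) + ζ₂` plus consensus of the estimates. The
consensus form is positive definite by connectedness (`exists_consensusForm_ge`), strong
monotonicity dissipates the action error, and the cross terms are absorbed once `θ` is large
(`exists_interconnection_bound`). Hence the squared seeking error is ultimately at most a constant
times the squared size of `ζ₂` (`exists_gain_seeking`). That constant and the threshold on `θ` do
not involve the target accuracy; only the threshold on `σ` does, which gives the order of
quantifiers.

Nash equilibria are the zeros of the pseudo-gradient, and a strongly monotone Lipschitz map has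
exactly one zero. Solutions exist for all time because the vector field is globally Lipschitz in the
state. -/

/-! ### Global solutions of Lipschitz differential equations -/

open Set in
/-- Picard–Lindelöf on an interval whose length depends only on the Lipschitz constant of a
globally Lipschitz vector field. -/
theorem exists_solution_Icc_of_lipschitzWith {E : Type*} [NormedAddCommGroup E] [NormedSpace ℝ E]
    [CompleteSpace E] {F : ℝ → E → E} {K : ℝ≥0} {s h : ℝ} (hh : 0 ≤ h) (hKh : 2 * (K + 1) * h ≤ 1)
    (hF : ∀ t ∈ Icc s (s + h), LipschitzWith K (F t))
    (hc : ∀ x, ContinuousOn (fun t => F t x) (Icc s (s + h))) (x₀ : E) :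
    ∃ α : ℝ → E, α s = x₀ ∧ ∀ t ∈ Icc s (s + h),
      HasDerivWithinAt α (F t (α t)) (Icc s (s + h)) t := by
  obtain ⟨M, hM⟩ := isCompact_Icc.exists_bound_of_continuousOn (hc x₀)
  have hs : s ∈ Icc s (s + h) := ⟨le_rfl, by linarith⟩
  have hM0 : 0 ≤ M := (norm_nonneg _).trans (hM s hs)
  lift M to ℝ≥0 using hM0
  -- On the ball of radius `M / (K + 1)` the speed is at most `2 * M`, so the solution stays inside
  -- for time `1 / (2 * (K + 1))`: the bound `M`, which depends on `x₀`, cancels.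
  have hPL : IsPicardLindelof F (⟨s, hs⟩ : Icc s (s + h)) x₀ (M / (K + 1)) 0 (2 * M) K := by
    refine ⟨fun t ht => (hF t ht).lipschitzOnWith, fun x _ => hc x, fun t ht x hx => ?_, ?_⟩
    · have h1 : ‖F t x - F t x₀‖ ≤ K * (M / (K + 1)) := by
        refine ((hF t ht).norm_sub_le x x₀).trans ?_
        gcongr
        simpa [dist_eq_norm] using hx
      have h2 : (K : ℝ) * (M / (K + 1)) ≤ M := by
        rw [mul_div_assoc', div_le_iff₀ (by positivity)]
        nlinarith [M.coe_nonneg]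
      have h3 : ‖F t x‖ ≤ ‖F t x - F t x₀‖ + ‖F t x₀‖ := by
        simpa using norm_add_le (F t x - F t x₀) (F t x₀)
      have := hM t ht
      push_cast
      linarith
    · simp only [add_sub_cancel_left, sub_self, NNReal.coe_zero, sub_zero, max_eq_left hh]
      push_cast
      rw [le_div_iff₀ (by positivity)]
      nlinarith [M.coe_nonneg]
  exact hPL.exists_eq_forall_mem_Icc_hasDerivWithinAt₀

open Set Filter Topology in
/-- Global existence for a globally Lipschitz vector field on `[t₀, ∞)`. -/
theorem exists_solution_Ici_of_lipschitzWith {E : Type*} [NormedAddCommGroup E] [NormedSpace ℝ E]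
    [CompleteSpace E] {F : ℝ → E → E} {K : ℝ≥0} {t₀ : ℝ}
    (hF : ∀ t ∈ Ici t₀, LipschitzWith K (F t))
    (hc : ∀ x, ContinuousOn (fun t => F t x) (Ici t₀)) (x₀ : E) :
    ∃ α : ℝ → E, α t₀ = x₀ ∧ ∀ t ∈ Ici t₀, HasDerivWithinAt α (F t (α t)) (Ici t₀) t := by
  obtain ⟨h, hh, hKh⟩ : ∃ h : ℝ, 0 < h ∧ 2 * (K + 1) * h ≤ 1 :=
    ⟨1 / (2 * (K + 1)), by positivity, by field_simp; rfl⟩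
  have step (n : ℕ) (x : E) : ∃ α : ℝ → E, α (t₀ + n * h) = x ∧
      ∀ t ∈ Icc (t₀ + n * h) (t₀ + n * h + h),
        HasDerivWithinAt α (F t (α t)) (Icc (t₀ + n * h) (t₀ + n * h + h)) t := by
    have hsub : Icc (t₀ + n * h) (t₀ + n * h + h) ⊆ Ici t₀ := fun t ht => by
      have : (0 : ℝ) ≤ n * h := by positivity
      exact (le_add_of_nonneg_right this).trans ht.1
    exact exists_solution_Icc_of_lipschitzWith hh.le hKh (fun t ht => hF t (hsub ht))
      (fun x => (hc x).mono hsub) x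
  choose φ hφ₀ hφ using step
  -- `e n` is the value at the node `t₀ + n * h`. The floor selects the piece starting at a node,
  -- and `e (n + 1)` is by definition the end value of the previous piece.
  let e : ℕ → E := fun n => Nat.rec x₀ (fun n x => φ n x (t₀ + n * h + h)) n
  let α : ℝ → E := fun t => φ ⌊(t - t₀) / h⌋₊ (e ⌊(t - t₀) / h⌋₊) t
  have succ_node (n : ℕ) : t₀ + n * h + h = t₀ + (n + 1 : ℕ) * h := by push_cast; ring
  have floor_eq {n : ℕ} {t : ℝ} (h₁ : t₀ + n * h ≤ t) (h₂ : t < t₀ + n * h + h) :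
      ⌊(t - t₀) / h⌋₊ = n := by
    have h0 : (0 : ℝ) ≤ n * h := by positivity
    rw [Nat.floor_eq_iff (div_nonneg (by linarith) hh.le), le_div_iff₀ hh, div_lt_iff₀ hh]
    constructor <;> linarith
  have α_node (n : ℕ) : α (t₀ + n * h) = e n := by
    simp only [α]
    rw [floor_eq le_rfl (by linarith), hφ₀]
  have α_eq {n : ℕ} {t : ℝ} (ht : t ∈ Icc (t₀ + n * h) (t₀ + n * h + h)) :
      α t = φ n (e n) t := by
    rcases ht.2.lt_or_eq with hlt | heq
    · simp only [α]
      rw [floor_eq ht.1 hlt]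
    · rw [heq, succ_node, α_node, ← succ_node]
  have α_deriv {n : ℕ} {t : ℝ} (ht : t ∈ Icc (t₀ + n * h) (t₀ + n * h + h)) :
      HasDerivWithinAt α (F t (α t)) (Icc (t₀ + n * h) (t₀ + n * h + h)) t := by
    rw [α_eq ht]
    exact (hφ n (e n) t ht).congr (fun u hu => α_eq hu) (α_eq ht)
  refine ⟨α, by simpa [e] using α_node 0, fun t ht => ?_⟩
  obtain ⟨n, hn₁, hn₂⟩ : ∃ n : ℕ, t₀ + n * h ≤ t ∧ t < t₀ + n * h + h := by
    have h0 : 0 ≤ (t - t₀) / h := div_nonneg (sub_nonneg.2 ht) hh.le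
    have h1 := Nat.floor_le h0
    have h2 := Nat.lt_floor_add_one ((t - t₀) / h)
    rw [le_div_iff₀ hh] at h1
    rw [div_lt_iff₀ hh] at h2
    exact ⟨⌊(t - t₀) / h⌋₊, by linarith, by linarith⟩
  have hR := α_deriv ⟨hn₁, hn₂.le⟩
  -- At an inner node the derivatives of the two adjacent pieces are joined; at `t₀` the right one
  -- suffices.
  rcases hn₁.lt_or_eq with hlt | rfl
  · exact (hR.hasDerivAt (Icc_mem_nhds hlt hn₂)).hasDerivWithinAt
  · cases n with
    | zero =>
      refine hR.mono_of_mem_nhdsWithin ?_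
      simpa using Icc_mem_nhdsGE (by linarith : t₀ < t₀ + h)
    | succ m =>
      have hL := α_deriv (n := m) ⟨by linarith [succ_node m], (succ_node m).ge⟩
      refine ((hL.union hR).hasDerivAt ?_).hasDerivWithinAt
      rw [succ_node m, Icc_union_Icc_eq_Icc (by linarith [succ_node m]) (by linarith)]
      exact Icc_mem_nhds (by linarith [succ_node m]) (by linarith)

/-! ### Existence and uniqueness of the Nash equilibrium -/

namespace NashSeeking

theorem pseudoGradient_apply {N : ℕ} (f : Fin N → Profile N → ℝ) (x : Profile N) (i : Fin N) :
    pseudoGradient f x i = partialDeriv (f i) i x := rfl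

/-- A common Lipschitz bound for all the partial derivatives. -/
theorem exists_common_lipschitz {N : ℕ} {f : Fin N → Profile N → ℝ}
    (hLip : ∀ i, ∃ K : ℝ≥0, LipschitzWith K (partialDeriv (f i) i)) :
    ∃ K : ℝ, 0 < K ∧ ∀ i x z, |partialDeriv (f i) i x - partialDeriv (f i) i z| ≤ K * ‖x - z‖ := by
  choose K hK using hLip
  refine ⟨∑ i, (K i : ℝ) + 1, by positivity, fun i x z => ?_⟩
  have h := (hK i).norm_sub_le x z
  rw [Real.norm_eq_abs] at h
  refine h.trans ?_
  gcongr
  have := Finset.single_le_sum (f := fun i => (K i : ℝ)) (fun j _ => (K j).coe_nonneg)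
    (Finset.mem_univ i)
  linarith

/-- A strongly monotone Lipschitz map on a real Hilbert space has a zero. -/
theorem exists_zero_of_strongly_monotone {E : Type*} [NormedAddCommGroup E]
    [InnerProductSpace ℝ E] [CompleteSpace E] {G : E → E} {m L : ℝ} (hm : 0 < m) (hL : 0 < L)
    (hmono : ∀ x z, m * ‖x - z‖ ^ 2 ≤ inner ℝ (x - z) (G x - G z))
    (hG : ∀ x z, ‖G x - G z‖ ≤ L * ‖x - z‖) : ∃ x, G x = 0 := by
  -- The map `x - γ • G x` has squared Lipschitz factor `q`, which is below 1 whenever `0 < γ < 2 *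
  -- m / L ^ 2`; this `γ` is in that range.
  set γ : ℝ := m / (L ^ 2 + m ^ 2) with hγ
  have hγ0 : 0 < γ := by positivity
  set q : ℝ := 1 - 2 * γ * m + γ ^ 2 * L ^ 2 with hq
  have hq_eq : q = L ^ 2 / (L ^ 2 + m ^ 2) - (m ^ 2 / (L ^ 2 + m ^ 2)) ^ 2 := by
    rw [hq, hγ]; field_simp; ring
  have hq1 : q < 1 := by
    rw [hq_eq]
    have : L ^ 2 / (L ^ 2 + m ^ 2) < 1 := by
      rw [div_lt_one (by positivity)]; nlinarith [pow_pos hm 2]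
    nlinarith [sq_nonneg (m ^ 2 / (L ^ 2 + m ^ 2))]
  have key (x z : E) : ‖(x - γ • G x) - (z - γ • G z)‖ ^ 2 ≤ q * ‖x - z‖ ^ 2 := by
    have e : (x - γ • G x) - (z - γ • G z) = (x - z) - γ • (G x - G z) := by
      rw [smul_sub]; abel
    rw [e, norm_sub_sq_real, inner_smul_right, norm_smul, Real.norm_eq_abs, abs_of_pos hγ0, hq,
      mul_pow]
    have h1 := mul_le_mul_of_nonneg_left (hmono x z) hγ0.le
    have h2 : ‖G x - G z‖ ^ 2 ≤ (L * ‖x - z‖) ^ 2 := by gcongr; exact hG x z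
    have h3 := mul_le_mul_of_nonneg_left h2 (sq_nonneg γ)
    nlinarith
  have hcontr : ContractingWith (Real.toNNReal √q) (fun x => x - γ • G x) := by
    refine ⟨by rw [Real.toNNReal_lt_one, Real.sqrt_lt' one_pos]; simpa using hq1, ?_⟩
    refine LipschitzWith.of_dist_le_mul fun x z => ?_
    rw [dist_eq_norm, dist_eq_norm, Real.coe_toNNReal _ (Real.sqrt_nonneg _)]
    -- Nonnegativity of `q` is read off from `key`, which needs two distinct points.
    by_cases hxz : ‖x - z‖ = 0
    · rw [sub_eq_zero.1 (norm_eq_zero.1 hxz)]; simp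
    · have hq0 : 0 ≤ q := by
        have h1 := (sq_nonneg _).trans (key x z)
        have h2 : 0 < ‖x - z‖ ^ 2 := by positivity
        exact nonneg_of_mul_nonneg_left h1 h2
      refine abs_le_of_sq_le_sq' ?_ (by positivity) |>.2
      rw [mul_pow, Real.sq_sqrt hq0]
      exact key x z
  refine ⟨hcontr.fixedPoint, ?_⟩
  have hfix : _ - γ • G _ = _ := hcontr.fixedPoint_isFixedPt
  rw [sub_eq_self] at hfix
  exact (smul_eq_zero.1 hfix).resolve_left hγ0.ne'

/-- The factor `N + 1`, cruder than `√N`, stays positive even for `N = 0`. -/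
theorem pseudoGradient_lipschitz {N : ℕ} {f : Fin N → Profile N → ℝ} {K : ℝ} (hK : 0 < K)
    (hLip : ∀ i x z, |partialDeriv (f i) i x - partialDeriv (f i) i z| ≤ K * ‖x - z‖)
    (x z : Profile N) :
    ‖pseudoGradient f x - pseudoGradient f z‖ ≤ (N + 1) * K * ‖x - z‖ := by
  refine abs_le_of_sq_le_sq' ?_ (by positivity) |>.2
  rw [EuclideanSpace.norm_sq_eq]
  calc ∑ i, ‖(pseudoGradient f x - pseudoGradient f z) i‖ ^ 2
      ≤ ∑ _i : Fin N, (K * ‖x - z‖) ^ 2 := by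
        gcongr with i
        exact hLip i x z
    _ = N * (K * ‖x - z‖) ^ 2 := by simp
    _ ≤ ((N + 1) * K * ‖x - z‖) ^ 2 := by
        rw [mul_assoc, mul_pow (_ + _)]
        gcongr
        nlinarith [(Nat.cast_nonneg N : (0 : ℝ) ≤ N)]

/-- Replacing the action of player `i` by `s` is a translation along the `i`-th axis. -/
theorem update_eq_add_single {N : ℕ} (xs : Profile N) (i : Fin N) (s : ℝ) :
    WithLp.toLp 2 (Function.update (fun j => xs j) i s)
      = xs + (s - xs i) • EuclideanSpace.single i (1 : ℝ) := by
  ext j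
  by_cases h : j = i
  · subst h; simp
  · simp [h]

theorem hasDerivAt_update {N : ℕ} {g : Profile N → ℝ} (hg : Differentiable ℝ g)
    (xs : Profile N) (i : Fin N) (s : ℝ) :
    HasDerivAt (fun s => g (WithLp.toLp 2 (Function.update (fun j => xs j) i s)))
      (partialDeriv g i (WithLp.toLp 2 (Function.update (fun j => xs j) i s))) s := by
  simp_rw [update_eq_add_single]
  have h1 : HasDerivAt (fun s : ℝ => xs + (s - xs i) • EuclideanSpace.single i (1 : ℝ))
      (EuclideanSpace.single i (1 : ℝ)) s := by
    simpa using (((hasDerivAt_id s).sub_const (xs i)).smul_const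
      (EuclideanSpace.single i (1 : ℝ))).const_add xs
  exact (hg _).hasFDerivAt.comp_hasDerivAt s h1

/-- Under strong monotonicity the Nash equilibria are the zeros of the pseudo-gradient. -/
theorem isNashEquilibrium_iff {N : ℕ} {f : Fin N → Profile N → ℝ}
    (hf : ∀ i, Differentiable ℝ (f i)) (hmono : StronglyMonotone f) (xs : Profile N) :
    IsNashEquilibrium f xs ↔ pseudoGradient f xs = 0 := by
  obtain ⟨m, hm, hmono⟩ := hmono
  have upd_self (i : Fin N) : WithLp.toLp 2 (Function.update (fun j => xs j) i (xs i)) = xs := by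
    simp
  constructor
  · intro h
    ext i
    have hmin : IsLocalMin
        (fun s => f i (WithLp.toLp 2 (Function.update (fun j => xs j) i s))) (xs i) :=
      Filter.Eventually.of_forall fun s => by
        simpa only [upd_self] using h i s
    have := hmin.hasDerivAt_eq_zero (hasDerivAt_update (hf i) xs i (xs i))
    rwa [upd_self] at this
  · intro h i s
    have h0 : partialDeriv (f i) i xs = 0 := by
      rw [← pseudoGradient_apply f xs i, h]; rfl
    set φ : ℝ → ℝ := fun s => f i (WithLp.toLp 2 (Function.update (fun j => xs j) i s)) with hφ
    have hd (s : ℝ) := hasDerivAt_update (hf i) xs i s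
    -- Monotonicity is tested on `xs` and its unilateral deviation. They differ along one axis and
    -- the pseudo-gradient vanishes at `xs`, so one component survives: the cost decreases before
    -- `xs i` and increases after it.
    have hsign (s : ℝ) : 0 ≤ (s - xs i) *
        partialDeriv (f i) i (WithLp.toLp 2 (Function.update (fun j => xs j) i s)) := by
      have := hmono (WithLp.toLp 2 (Function.update (fun j => xs j) i s)) xs
      rw [h, sub_zero, update_eq_add_single, add_sub_cancel_left, inner_smul_left,
        EuclideanSpace.inner_single_left] at this
      simp only [map_one, one_mul, conj_trivial, pseudoGradient_apply] at this
      rw [update_eq_add_single]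
      exact (by positivity : (0 : ℝ) ≤ _).trans this
    have hcont : Continuous φ := continuous_iff_continuousAt.2 fun s => (hd s).continuousAt
    have goal : φ (xs i) ≤ φ s := by
      rcases le_total (xs i) s with hs | hs
      · refine monotoneOn_of_deriv_nonneg (convex_Ici (xs i)) hcont.continuousOn
          (fun s _ => (hd s).differentiableAt.differentiableWithinAt) (fun u hu => ?_)
          Set.self_mem_Ici hs hs
        rw [interior_Ici, Set.mem_Ioi] at hu
        rw [(hd u).deriv]
        exact nonneg_of_mul_nonneg_right (hsign u) (sub_pos.2 hu)
      · refine antitoneOn_of_deriv_nonpos (convex_Iic (xs i)) hcont.continuousOn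
          (fun s _ => (hd s).differentiableAt.differentiableWithinAt) (fun u hu => ?_)
          hs Set.self_mem_Iic hs
        rw [interior_Iic, Set.mem_Iio] at hu
        rw [(hd u).deriv]
        have := hsign u
        by_contra! hpos
        nlinarith
    simpa only [hφ, upd_self] using goal

theorem existsUnique_isNashEquilibrium {N : ℕ} {f : Fin N → Profile N → ℝ}
    (hf : ∀ i, Differentiable ℝ (f i)) (hmono : StronglyMonotone f)
    (hLip : ∀ i, ∃ K : ℝ≥0, LipschitzWith K (partialDeriv (f i) i)) :
    ∃! xs : Profile N, IsNashEquilibrium f xs := by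
  simp only [isNashEquilibrium_iff hf hmono]
  obtain ⟨m, hm, hmono⟩ := hmono
  obtain ⟨K, hK, hLip⟩ := exists_common_lipschitz hLip
  obtain ⟨x, hx⟩ := exists_zero_of_strongly_monotone hm (by positivity : 0 < (N + 1) * K) hmono
    (pseudoGradient_lipschitz hK hLip)
  refine ⟨x, hx, fun z hz => ?_⟩
  have hz : pseudoGradient f z = 0 := hz
  have h := hmono z x
  rw [hz, hx, sub_zero, inner_zero_right] at h
  have h2 : ‖z - x‖ ^ 2 ≤ 0 := by
    by_contra! hpos
    nlinarith
  exact sub_eq_zero.1 (norm_eq_zero.1 (pow_eq_zero_iff two_ne_zero |>.1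
    (le_antisymm h2 (sq_nonneg _))))

end NashSeeking

/-! ### Differential inequality and high-gain observer -/

open Filter Set Topology in
/-- A differential inequality `V' ≤ -c V + b` makes `V` ultimately at most `b / c + δ`. -/
theorem eventually_le_of_hasDerivAt_le {V V' : ℝ → ℝ} {b c δ : ℝ} (hc : 0 < c) (hδ : 0 < δ)
    (hV : ∀ᶠ t in atTop, HasDerivAt V (V' t) t) (hle : ∀ᶠ t in atTop, V' t ≤ -c * V t + b) :
    ∀ᶠ t in atTop, V t ≤ b / c + δ := by
  obtain ⟨T, hT⟩ := eventually_atTop.1 (hV.and hle)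
  -- Integrating factor: the inequality says exactly that `W` is nonincreasing.
  set W : ℝ → ℝ := fun t => (V t - b / c) * Real.exp (c * t) with hW
  have hWd (t : ℝ) (ht : T ≤ t) : HasDerivAt W
      (V' t * Real.exp (c * t) + (V t - b / c) * (Real.exp (c * t) * (c * 1))) t :=
    ((hT t ht).1.sub_const (b / c)).mul ((hasDerivAt_id t).const_mul c).exp
  have hanti : AntitoneOn W (Ici T) := by
    refine antitoneOn_of_deriv_nonpos (convex_Ici T)
      (fun t ht => (hWd t ht).continuousAt.continuousWithinAt)
      (fun t ht => (hWd t (interior_subset ht)).differentiableAt.differentiableWithinAt)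
      fun t ht => ?_
    have ht := interior_subset ht
    rw [(hWd t ht).deriv]
    have h1 := (hT t ht).2
    have h2 : V' t + (V t - b / c) * c ≤ 0 := by
      rw [sub_mul, div_mul_cancel₀ _ hc.ne']; linarith
    nlinarith [Real.exp_pos (c * t)]
  have hlim : Tendsto (fun t => W T * Real.exp (-(c * t))) atTop (𝓝 0) := by
    simpa using (Real.tendsto_exp_neg_atTop_nhds_zero.comp
      (tendsto_id.const_mul_atTop hc)).const_mul (W T)
  filter_upwards [eventually_ge_atTop T, hlim.eventually (gt_mem_nhds hδ)] with t ht hlt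
  have h1 : W t ≤ W T := hanti self_mem_Ici ht ht
  have h2 : V t - b / c = W t * Real.exp (-(c * t)) := by
    rw [hW]; dsimp only; rw [mul_assoc, ← Real.exp_add]; simp
  have h3 := mul_le_mul_of_nonneg_right h1 (Real.exp_pos (-(c * t))).le
  linarith

open Filter Set Topology in
/-- Ultimate bound for the errors of the high-gain extended state observer. -/
theorem exists_gain_observer {k₁ k₂ D ε : ℝ} (hk₁ : 0 < k₁) (hk₂ : 0 < k₂) (hε : 0 < ε) :
    ∃ σs : ℝ, 0 < σs ∧ ∀ σ, σs < σ → ∀ ζ₁ ζ₂ δ : ℝ → ℝ,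
      (∀ᶠ t in atTop, HasDerivAt ζ₁ (ζ₂ t - σ * k₁ * ζ₁ t) t) →
      (∀ᶠ t in atTop, HasDerivAt ζ₂ (δ t - σ ^ 2 * k₂ * ζ₁ t) t) →
      (∀ᶠ t in atTop, |δ t| ≤ D) →
      ∀ᶠ t in atTop, ζ₁ t ^ 2 ≤ ε ^ 2 ∧ ζ₂ t ^ 2 ≤ ε ^ 2 := by
  -- `α e₁² - e₁ e₂ + γ e₂²` solves the Lyapunov equation with right-hand side `-(e₁² + e₂²)`.
  set α : ℝ := (1 + k₂) / (2 * k₁) with hα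
  set γ : ℝ := (α + k₁ / 2) / k₂ with hγ
  have hα0 : 0 < α := by positivity
  have hγ0 : 0 < γ := by positivity
  have hαk : 2 * α * k₁ = 1 + k₂ := by rw [hα]; field_simp
  have hγk : γ * k₂ = α + k₁ / 2 := by rw [hγ]; field_simp
  -- Positive definiteness of the form. Completing the square in either variable leaves `α - 1 / (4
  -- * γ)` or `γ - 1 / (4 * α)`, whose minimum `p` bounds the form below in each variable.
  have hdet : 1 < 4 * α * γ := by
    have : 1 * k₂ < 4 * α * γ * k₂ := by
      calc 1 * k₂ < 2 * α * k₁ := by linarith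
        _ ≤ 4 * α * (γ * k₂) := by rw [hγk]; nlinarith
        _ = 4 * α * γ * k₂ := by ring
    exact lt_of_mul_lt_mul_right this hk₂.le
  have hp₁ : 0 < α - 1 / (4 * γ) := by
    rw [sub_pos, div_lt_iff₀ (by positivity)]; linarith
  have hp₂ : 0 < γ - 1 / (4 * α) := by
    rw [sub_pos, div_lt_iff₀ (by positivity)]; linarith
  obtain ⟨p, hp, hpα, hpγ⟩ : ∃ p : ℝ, 0 < p ∧ p ≤ α - 1 / (4 * γ) ∧ p ≤ γ - 1 / (4 * α) :=
    ⟨_, lt_min hp₁ hp₂, min_le_left _ _, min_le_right _ _⟩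
  set q : ℝ := α + γ + 1 / 2 with hq
  have hq0 : 0 < q := by positivity
  set M : ℝ := (1 + 4 * γ ^ 2) * D ^ 2 * q with hM
  have hM0 : 0 ≤ M := by positivity
  -- `V` is ultimately at most `M / σ ^ 2` plus a slack `p * ε ^ 2 / 2`. Since `σ > 1`, `σ ^ 2`
  -- exceeds `2 * M / (p * ε ^ 2)`, so the first part is at most the slack; `σ > 1` also allows
  -- undoing the rescaling of `ζ₁`.
  refine ⟨1 + 2 * M / (p * ε ^ 2), by positivity, fun σ hσ ζ₁ ζ₂ δ h₁ h₂ hδ => ?_⟩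
  have hσM : 2 * M / (p * ε ^ 2) < σ := by linarith
  have hσ1 : 1 < σ := by
    have : 0 ≤ 2 * M / (p * ε ^ 2) := by positivity
    linarith
  have hσ0 : 0 < σ := by linarith
  -- In the variables `e₁ = σ * ζ₁`, `e₂ = ζ₂` the linear part of the system is `σ` times a fixed
  -- matrix.
  set V : ℝ → ℝ := fun t => α * (σ * ζ₁ t) ^ 2 - (σ * ζ₁ t) * ζ₂ t + γ * ζ₂ t ^ 2 with hV
  set V' : ℝ → ℝ := fun t => -σ * ((σ * ζ₁ t) ^ 2 + ζ₂ t ^ 2)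
    + δ t * (-(σ * ζ₁ t) + 2 * γ * ζ₂ t) with hV'
  have hVd : ∀ᶠ t in atTop, HasDerivAt V (V' t) t := by
    filter_upwards [h₁, h₂] with t h₁ h₂
    have h₁' := h₁.const_mul σ
    refine ((((h₁'.pow 2).const_mul α).sub (h₁'.mul h₂)).add
      ((h₂.pow 2).const_mul γ)).congr_deriv ?_
    simp only [hV', Nat.cast_ofNat, Nat.add_one_sub_one, pow_one]
    linear_combination -σ * (σ * ζ₁ t) ^ 2 * hαk - 2 * σ * (σ * ζ₁ t) * ζ₂ t * hγk
  have hVle : ∀ᶠ t in atTop,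
      V' t ≤ -(σ / (2 * q)) * V t + (1 + 4 * γ ^ 2) * D ^ 2 / (2 * σ) := by
    filter_upwards [hδ] with t hδ
    set e₁ := σ * ζ₁ t
    set e₂ := ζ₂ t
    have hVq : V t ≤ q * (e₁ ^ 2 + e₂ ^ 2) := by
      simp only [hV, hq]
      nlinarith [sq_nonneg (e₁ + e₂), mul_nonneg hα0.le (sq_nonneg e₂),
        mul_nonneg hγ0.le (sq_nonneg e₁)]
    have hδ2 : δ t ^ 2 ≤ D ^ 2 := by
      rw [← sq_abs (δ t)]; gcongr
    -- Young's inequality spends half of the dissipation `σ * (e₁ ^ 2 + e₂ ^ 2)`.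
    have hY : δ t * (-e₁ + 2 * γ * e₂)
        ≤ σ / 2 * (e₁ ^ 2 + e₂ ^ 2) + (1 + 4 * γ ^ 2) * δ t ^ 2 / (2 * σ) := by
      have : σ / 2 * (e₁ ^ 2 + e₂ ^ 2) + (1 + 4 * γ ^ 2) * δ t ^ 2 / (2 * σ)
          - δ t * (-e₁ + 2 * γ * e₂)
          = ((σ * e₁ + δ t) ^ 2 + (σ * e₂ - 2 * γ * δ t) ^ 2) / (2 * σ) := by
        field_simp; ring
      have h0 : 0 ≤ ((σ * e₁ + δ t) ^ 2 + (σ * e₂ - 2 * γ * δ t) ^ 2) / (2 * σ) := by positivity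
      linarith
    have hY2 : (1 + 4 * γ ^ 2) * δ t ^ 2 / (2 * σ) ≤ (1 + 4 * γ ^ 2) * D ^ 2 / (2 * σ) := by
      gcongr
    have hVq2 : σ / (2 * q) * V t ≤ σ / 2 * (e₁ ^ 2 + e₂ ^ 2) := by
      calc σ / (2 * q) * V t ≤ σ / (2 * q) * (q * (e₁ ^ 2 + e₂ ^ 2)) := by gcongr
        _ = σ / 2 * (e₁ ^ 2 + e₂ ^ 2) := by field_simp
    simp only [hV']
    linarith
  have hfin := eventually_le_of_hasDerivAt_le (by positivity : 0 < σ / (2 * q))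
    (by positivity : 0 < p * ε ^ 2 / 2) hVd hVle
  have hb : (1 + 4 * γ ^ 2) * D ^ 2 / (2 * σ) / (σ / (2 * q)) ≤ p * ε ^ 2 / 2 := by
    have e : (1 + 4 * γ ^ 2) * D ^ 2 / (2 * σ) / (σ / (2 * q)) = M / σ ^ 2 := by
      rw [hM]; field_simp
    rw [e, div_le_iff₀ (by positivity)]
    rw [div_lt_iff₀ (by positivity)] at hσM
    have h1 : σ * (p * ε ^ 2) ≤ σ ^ 2 * (p * ε ^ 2) := by
      gcongr; nlinarith
    linarith
  filter_upwards [hfin] with t ht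
  have hVp : V t ≤ p * ε ^ 2 := by linarith
  have hV₁ : p * (σ * ζ₁ t) ^ 2 ≤ V t := by
    have e : V t = (α - 1 / (4 * γ)) * (σ * ζ₁ t) ^ 2
        + γ * (ζ₂ t - (σ * ζ₁ t) / (2 * γ)) ^ 2 := by
      simp only [hV]; field_simp; ring
    have : p * (σ * ζ₁ t) ^ 2 ≤ (α - 1 / (4 * γ)) * (σ * ζ₁ t) ^ 2 := by gcongr
    have : 0 ≤ γ * (ζ₂ t - (σ * ζ₁ t) / (2 * γ)) ^ 2 := by positivity
    linarith
  have hV₂ : p * ζ₂ t ^ 2 ≤ V t := by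
    have e : V t = (γ - 1 / (4 * α)) * ζ₂ t ^ 2
        + α * (σ * ζ₁ t - ζ₂ t / (2 * α)) ^ 2 := by
      simp only [hV]; field_simp; ring
    have : p * ζ₂ t ^ 2 ≤ (γ - 1 / (4 * α)) * ζ₂ t ^ 2 := by gcongr
    have : 0 ≤ α * (σ * ζ₁ t - ζ₂ t / (2 * α)) ^ 2 := by positivity
    linarith
  constructor
  · have h1 : (σ * ζ₁ t) ^ 2 ≤ ε ^ 2 := le_of_mul_le_mul_left (hV₁.trans hVp) hp
    have h2 : 1 * ζ₁ t ^ 2 ≤ σ ^ 2 * ζ₁ t ^ 2 := by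
      gcongr; nlinarith
    rw [mul_pow] at h1
    linarith
  · exact le_of_mul_le_mul_left (hV₂.trans hVp) hp

/-! ### Coercivity of the consensus form -/

/-- A continuous, positive definite, 2-homogeneous function on a finite-dimensional space is
bounded below by a multiple of the squared norm. -/
theorem exists_pos_mul_norm_sq_le {E : Type*} [NormedAddCommGroup E] [NormedSpace ℝ E]
    [FiniteDimensional ℝ E] {Q : E → ℝ} (hQ : Continuous Q)
    (hsmul : ∀ (c : ℝ) x, Q (c • x) = c ^ 2 * Q x) (hpos : ∀ x, x ≠ 0 → 0 < Q x) :
    ∃ l : ℝ, 0 < l ∧ ∀ x, l * ‖x‖ ^ 2 ≤ Q x := by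
  have hQ0 : Q 0 = 0 := by simpa using hsmul 0 0
  rcases (Metric.sphere (0 : E) 1).eq_empty_or_nonempty with hS | hS
  · refine ⟨1, one_pos, fun x => ?_⟩
    by_cases hx : x = 0
    · simp [hx, hQ0]
    · have hmem : ‖x‖⁻¹ • x ∈ Metric.sphere (0 : E) 1 := by
        simp [norm_smul, hx]
      rw [hS] at hmem
      exact hmem.elim
  · have : ProperSpace E := FiniteDimensional.proper ℝ E
    obtain ⟨z, hz, hmin⟩ := (isCompact_sphere (0 : E) 1).exists_isMinOn hS hQ.continuousOn
    have hz0 : z ≠ 0 := by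
      rintro rfl
      simp at hz
    refine ⟨Q z, hpos z hz0, fun x => ?_⟩
    by_cases hx : x = 0
    · simp [hx, hQ0]
    · have hmem : ‖x‖⁻¹ • x ∈ Metric.sphere (0 : E) 1 := by
        simp [norm_smul, hx]
      have h := hmin hmem
      simp only [Set.mem_ofPred_eq, hsmul] at h
      have hx' : 0 < ‖x‖ := norm_pos_iff.2 hx
      calc Q z * ‖x‖ ^ 2 ≤ (‖x‖⁻¹ ^ 2 * Q x) * ‖x‖ ^ 2 := by gcongr
        _ = Q x := by field_simp

namespace NashSeeking

/-- The quadratic form of the leader-following consensus dynamics. -/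
def consensusForm {N : ℕ} (a : Matrix (Fin N) (Fin N) ℝ) (η : Fin N → Fin N → ℝ) : ℝ :=
  ∑ i, ∑ j, η i j * ((∑ k, a i k * (η i j - η k j)) + a i j * η i j)

/-- By symmetry of `a`, swapping `i` and `k` and averaging turns the Laplacian part into a sum of
squares, separately for each column `j`. -/
theorem consensusForm_eq {N : ℕ} {a : Matrix (Fin N) (Fin N) ℝ} (hsymm : ∀ i j, a i j = a j i)
    (η : Fin N → Fin N → ℝ) :
    consensusForm a η = ∑ j, ((∑ i, ∑ k, a i k * (η i j - η k j) ^ 2) / 2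
      + ∑ i, a i j * η i j ^ 2) := by
  rw [consensusForm, Finset.sum_comm]
  refine Finset.sum_congr rfl fun j _ => ?_
  have h1 : ∑ i, ∑ k, a i k * (η i j - η k j) * η k j
      = -∑ i, ∑ k, a i k * (η i j - η k j) * η i j := by
    rw [Finset.sum_comm, ← Finset.sum_neg_distrib]
    refine Finset.sum_congr rfl fun i _ => ?_
    rw [← Finset.sum_neg_distrib]
    refine Finset.sum_congr rfl fun k _ => ?_
    rw [hsymm k i]; ring
  have h2 : ∑ i, ∑ k, a i k * (η i j - η k j) ^ 2
      = ∑ i, ∑ k, a i k * (η i j - η k j) * η i j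
        - ∑ i, ∑ k, a i k * (η i j - η k j) * η k j := by
    rw [← Finset.sum_sub_distrib]
    refine Finset.sum_congr rfl fun i _ => ?_
    rw [← Finset.sum_sub_distrib]
    refine Finset.sum_congr rfl fun k _ => ?_
    ring
  rw [h2, h1, sub_neg_eq_add, add_self_div_two, ← Finset.sum_add_distrib]
  refine Finset.sum_congr rfl fun i _ => ?_
  rw [← Finset.sum_mul]
  ring

/-- All squares must vanish. Column `j` is then constant along edges, hence constant by
connectedness, and it is zero at the neighbours of `j`; one exists because `N ≥ 2`. -/
theorem eq_zero_of_consensusForm_nonpos {N : ℕ} (hN : 2 ≤ N) {a : Matrix (Fin N) (Fin N) ℝ}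
    (ha : IsUndirectedConnected a) {η : Fin N → Fin N → ℝ} (h : consensusForm a η ≤ 0) :
    η = 0 := by
  have hE (i k j : Fin N) : 0 ≤ a i k * (η i j - η k j) ^ 2 :=
    mul_nonneg (ha.nonneg i k) (sq_nonneg _)
  have hB (i j : Fin N) : 0 ≤ a i j * η i j ^ 2 := mul_nonneg (ha.nonneg i j) (sq_nonneg _)
  have hE' (j : Fin N) : 0 ≤ ∑ i, ∑ k, a i k * (η i j - η k j) ^ 2 :=
    Finset.sum_nonneg fun i _ => Finset.sum_nonneg fun k _ => hE i k j
  have hB' (j : Fin N) : 0 ≤ ∑ i, a i j * η i j ^ 2 := Finset.sum_nonneg fun i _ => hB i j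
  rw [consensusForm_eq ha.symm] at h
  have hnn (j : Fin N) : 0 ≤ (∑ i, ∑ k, a i k * (η i j - η k j) ^ 2) / 2
      + ∑ i, a i j * η i j ^ 2 := by linarith [hE' j, hB' j]
  have hz (j : Fin N) := (Finset.sum_eq_zero_iff_of_nonneg fun j _ => hnn j).1
    (le_antisymm h (Finset.sum_nonneg fun j _ => hnn j)) j (Finset.mem_univ j)
  have hedge (i k j : Fin N) (hik : 0 < a i k) : η i j = η k j := by
    have h0 : ∑ i, ∑ k, a i k * (η i j - η k j) ^ 2 = 0 := by
      linarith [hE' j, hB' j, hz j]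
    rw [Finset.sum_eq_zero_iff_of_nonneg
      fun i _ => Finset.sum_nonneg fun k _ => hE i k j] at h0
    have h1 := h0 i (Finset.mem_univ i)
    rw [Finset.sum_eq_zero_iff_of_nonneg fun k _ => hE i k j] at h1
    have h2 := (mul_eq_zero.1 (h1 k (Finset.mem_univ k))).resolve_left hik.ne'
    exact sub_eq_zero.1 (pow_eq_zero_iff two_ne_zero |>.1 h2)
  have hpin (i j : Fin N) (hij : 0 < a i j) : η i j = 0 := by
    have h0 : ∑ i, a i j * η i j ^ 2 = 0 := by linarith [hE' j, hB' j, hz j]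
    rw [Finset.sum_eq_zero_iff_of_nonneg fun i _ => hB i j] at h0
    have h2 := (mul_eq_zero.1 (h0 i (Finset.mem_univ i))).resolve_left hij.ne'
    exact pow_eq_zero_iff two_ne_zero |>.1 h2
  have hpos_of_adj {i k : Fin N} (hik : (SimpleGraph.fromRel fun i j => 0 < a i j).Adj i k) :
      0 < a i k := by
    rcases (SimpleGraph.fromRel_adj _ _ _).1 hik with ⟨_, h | h⟩
    · exact h
    · rwa [ha.symm]
  have hconst (j : Fin N) {i k : Fin N}
      (w : (SimpleGraph.fromRel fun i j => 0 < a i j).Walk i k) : η i j = η k j := by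
    induction w with
    | nil => rfl
    | cons hadj _ ih => exact (hedge _ _ j (hpos_of_adj hadj)).trans ih
  have : Nontrivial (Fin N) := Fin.nontrivial_iff_two_le.2 hN
  funext i j
  obtain ⟨l, hl⟩ := ha.connected.preconnected.exists_adj_of_nontrivial j
  obtain ⟨w⟩ := ha.connected.preconnected i l
  rw [hconst j w, hpin l j (by rw [ha.symm]; exact hpos_of_adj hl)]
  rfl

/-- Compactness of the unit sphere replaces an eigenvalue argument; `l` is the coercivity that the
gain `θ` multiplies. -/
theorem exists_consensusForm_ge {N : ℕ} (hN : 2 ≤ N) {a : Matrix (Fin N) (Fin N) ℝ}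
    (ha : IsUndirectedConnected a) :
    ∃ l : ℝ, 0 < l ∧ ∀ η : Fin N → Fin N → ℝ, l * ∑ i, ∑ j, η i j ^ 2 ≤ consensusForm a η := by
  obtain ⟨l, hl, h⟩ := exists_pos_mul_norm_sq_le (E := EuclideanSpace ℝ (Fin N × Fin N))
    (Q := fun η => consensusForm a fun i j => η (i, j)) (by unfold consensusForm; fun_prop)
    (fun c η => by
      simp only [consensusForm, Finset.mul_sum, PiLp.smul_apply, smul_eq_mul]
      refine Finset.sum_congr rfl fun i _ => Finset.sum_congr rfl fun j _ => ?_
      rw [mul_add, mul_add, mul_add, Finset.mul_sum, Finset.mul_sum, Finset.mul_sum]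
      congr 1
      · exact Finset.sum_congr rfl fun k _ => by ring
      · ring)
    (fun η hη => by
      by_contra! hle
      have h0 := eq_zero_of_consensusForm_nonpos hN ha hle
      exact hη (by ext p; exact congrFun (congrFun h0 p.1) p.2))
  refine ⟨l, hl, fun η => ?_⟩
  have := h (WithLp.toLp 2 fun p => η p.1 p.2)
  simpa [EuclideanSpace.norm_sq_eq, Fintype.sum_prod_type] using this

/-! ### Lyapunov analysis of the seeking dynamics -/

/-- The weighted squared norm of the estimation errors `y i j - x j` and the action errors
`x i - xs i`, a Lyapunov function of the seeking dynamics. -/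
noncomputable def seekingEnergy {N : ℕ} (θbar : Fin N → Fin N → ℝ) (xs x : Profile N)
    (y : Fin N → Profile N) : ℝ :=
  ∑ i, ∑ j, (y i j - x j) ^ 2 / (2 * θbar i j) + ∑ i, (x i - xs i) ^ 2 / 2

theorem exists_seekingEnergy_bounds {N : ℕ} {θbar : Fin N → Fin N → ℝ}
    (hθbar : ∀ i j, 0 < θbar i j) (xs : Profile N) :
    ∃ p q : ℝ, 0 < p ∧ 0 < q ∧ ∀ x y,
      p * (∑ i, ∑ j, (y i j - x j) ^ 2 + ∑ i, (x i - xs i) ^ 2) ≤ seekingEnergy θbar xs x y ∧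
      seekingEnergy θbar xs x y ≤
        q * (∑ i, ∑ j, (y i j - x j) ^ 2 + ∑ i, (x i - xs i) ^ 2) := by
  -- The sums dominate every entry, and the added 1 lets the same constants cover the action terms,
  -- whose weight is `1 / 2`.
  set B : ℝ := ∑ i, ∑ j, θbar i j + 1 with hB
  set C : ℝ := ∑ i, ∑ j, (θbar i j)⁻¹ + 1 with hC
  have hB1 : 1 ≤ B := by
    have : 0 ≤ ∑ i, ∑ j, θbar i j :=
      Finset.sum_nonneg fun i _ => Finset.sum_nonneg fun j _ => (hθbar i j).le
    linarith
  have hC1 : 1 ≤ C := by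
    have : 0 ≤ ∑ i, ∑ j, (θbar i j)⁻¹ :=
      Finset.sum_nonneg fun i _ => Finset.sum_nonneg fun j _ => (inv_pos.2 (hθbar i j)).le
    linarith
  have le_double_sum {g : Fin N → Fin N → ℝ} (hg : ∀ i j, 0 < g i j) (i j : Fin N) :
      g i j ≤ ∑ i, ∑ j, g i j :=
    (Finset.single_le_sum (f := g i) (fun j _ => (hg i j).le) (Finset.mem_univ j)).trans
      (Finset.single_le_sum (f := fun i => ∑ j, g i j)
        (fun i _ => Finset.sum_nonneg fun j _ => (hg i j).le) (Finset.mem_univ i))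
  have hθB (i j : Fin N) : θbar i j ≤ B := by linarith [le_double_sum hθbar i j]
  have hθC (i j : Fin N) : (θbar i j)⁻¹ ≤ C := by
    linarith [le_double_sum (fun i j => inv_pos.2 (hθbar i j)) i j]
  refine ⟨1 / (2 * B), C / 2, by positivity, by positivity, fun x y => ⟨?_, ?_⟩⟩
  · rw [mul_add, seekingEnergy, Finset.mul_sum, Finset.mul_sum]
    gcongr with i _ i _
    · rw [Finset.mul_sum]
      gcongr with j
      have := hθbar i j
      rw [one_div_mul_eq_div]
      gcongr
      exact hθB i j
    · rw [one_div_mul_eq_div]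
      gcongr
      linarith
  · rw [mul_add, seekingEnergy, Finset.mul_sum, Finset.mul_sum]
    gcongr with i _ i _
    · rw [Finset.mul_sum]
      gcongr with j
      have h := mul_le_mul_of_nonneg_right (hθC i j) (sq_nonneg (y i j - x j))
      have e : (y i j - x j) ^ 2 / (2 * θbar i j) = (θbar i j)⁻¹ * (y i j - x j) ^ 2 / 2 := by
        have := (hθbar i j).ne'
        field_simp
      rw [e]
      linarith
    · nlinarith [sq_nonneg (x i - xs i)]

/-- Bound for the contribution of the velocities `u` to the derivative of the energy. -/
theorem exists_interconnection_bound {N : ℕ} (hN : 0 < N) {f : Fin N → Profile N → ℝ} {K m : ℝ}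
    (hK : 0 < K) (hm : 0 < m)
    (hLip : ∀ i x z, |partialDeriv (f i) i x - partialDeriv (f i) i z| ≤ K * ‖x - z‖)
    (hmono : ∀ x z : Profile N,
      m * ‖x - z‖ ^ 2 ≤ inner ℝ (x - z) (pseudoGradient f x - pseudoGradient f z))
    {θbar : Fin N → Fin N → ℝ} {xs : Profile N} (hxs : pseudoGradient f xs = 0) :
    ∃ C₁ C₂ : ℝ, 0 < C₁ ∧ 0 < C₂ ∧ ∀ (x : Profile N) (y : Fin N → Profile N) (ζ : Fin N → ℝ),
      ∑ i, (x i - xs i) * (-partialDeriv (f i) i (y i) + ζ i)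
        - ∑ i, ∑ j, (y i j - x j) / θbar i j * (-partialDeriv (f j) j (y j) + ζ j)
      ≤ C₁ * ∑ i, ∑ j, (y i j - x j) ^ 2 - m / 4 * ∑ i, (x i - xs i) ^ 2
        + C₂ * ∑ i, ζ i ^ 2 := by
  have hN' : (0 : ℝ) < N := by exact_mod_cast hN
  set β : ℝ := ∑ i, ∑ j, ((θbar i j)⁻¹) ^ 2 with hβ
  have hβ0 : 0 ≤ β := by positivity
  have hθβ (i j : Fin N) : ((θbar i j)⁻¹) ^ 2 ≤ β :=
    (Finset.single_le_sum (f := fun j => ((θbar i j)⁻¹) ^ 2) (fun j _ => sq_nonneg _)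
      (Finset.mem_univ j)).trans
      (Finset.single_le_sum (f := fun i => ∑ j, ((θbar i j)⁻¹) ^ 2)
        (fun i _ => Finset.sum_nonneg fun j _ => sq_nonneg _) (Finset.mem_univ i))
  -- Young parameter for the estimation errors, chosen so that their `R`-term is exactly `m / 4 * R`
  -- (`h7`).
  set δ : ℝ := m / (12 * N ^ 2 * K ^ 2) with hδ
  have hδ0 : 0 < δ := by positivity
  refine ⟨K ^ 2 / m + β / (4 * δ) + 3 * δ * N * K ^ 2, 1 / m + 3 * δ * N, by positivity,
    by positivity, fun x y ζ => ?_⟩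
  set P := ∑ i, ∑ j, (y i j - x j) ^ 2 with hP
  set R := ∑ i, (x i - xs i) ^ 2 with hR
  set Z := ∑ i, ζ i ^ 2 with hZ
  set u : Fin N → ℝ := fun i => -partialDeriv (f i) i (y i) + ζ i with hu
  have hRn : ‖x - xs‖ ^ 2 = R := by simp [EuclideanSpace.norm_sq_eq, hR]
  have hYn (i : Fin N) : ‖y i - x‖ ^ 2 = ∑ j, (y i j - x j) ^ 2 := by
    simp [EuclideanSpace.norm_sq_eq]
  have hLip2 (i : Fin N) (w z : Profile N) :
      (partialDeriv (f i) i w - partialDeriv (f i) i z) ^ 2 ≤ K ^ 2 * ‖w - z‖ ^ 2 := by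
    rw [← mul_pow, ← sq_abs]
    gcongr
    exact hLip i w z
  have hg0 (i : Fin N) : partialDeriv (f i) i xs = 0 := by
    rw [← pseudoGradient_apply f xs i, hxs]; rfl
  have hmono' : m * R ≤ ∑ i, (x i - xs i) * partialDeriv (f i) i x := by
    have h := hmono x xs
    rw [hxs, sub_zero, hRn, PiLp.inner_apply] at h
    simpa [pseudoGradient_apply, mul_comm] using h
  -- Of the dissipation `m * R`, two Young inequalities, against the gradient mismatch and against
  -- `ζ`, use `m / 4 * R` each. The velocity bound below uses another quarter, leaving `m / 4 * R`.
  have hξ : ∑ i, (x i - xs i) * u i ≤ -(m / 2) * R + K ^ 2 / m * P + 1 / m * Z := by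
    have hterm (i : Fin N) : (x i - xs i) * u i ≤ -((x i - xs i) * partialDeriv (f i) i x)
        + m / 2 * (x i - xs i) ^ 2 + K ^ 2 / m * (∑ j, (y i j - x j) ^ 2) + 1 / m * ζ i ^ 2 := by
      have h1 := hLip2 i (y i) x
      rw [hYn] at h1
      set w := partialDeriv (f i) i (y i) - partialDeriv (f i) i x with hw
      have h2 : 1 / m * w ^ 2 ≤ K ^ 2 / m * (∑ j, (y i j - x j) ^ 2) := by
        calc 1 / m * w ^ 2 ≤ 1 / m * (K ^ 2 * ∑ j, (y i j - x j) ^ 2) := by gcongr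
          _ = _ := by ring
      have h3 : (x i - xs i) * u i = -((x i - xs i) * partialDeriv (f i) i x)
          + m / 2 * (x i - xs i) ^ 2 + 1 / m * w ^ 2 + 1 / m * ζ i ^ 2
          - (m / 2 * (x i - xs i) + w) ^ 2 / m - (m / 2 * (x i - xs i) - ζ i) ^ 2 / m := by
        simp only [hu, hw]; field_simp; ring
      have h4 : 0 ≤ (m / 2 * (x i - xs i) + w) ^ 2 / m := by positivity
      have h5 : 0 ≤ (m / 2 * (x i - xs i) - ζ i) ^ 2 / m := by positivity
      linarith
    have hsum := Finset.sum_le_sum fun i (_ : i ∈ Finset.univ) => hterm i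
    rw [Finset.sum_add_distrib, Finset.sum_add_distrib, Finset.sum_add_distrib,
      Finset.sum_neg_distrib, ← Finset.mul_sum, ← Finset.mul_sum, ← Finset.mul_sum] at hsum
    linarith
  have hu2 : ∑ i, u i ^ 2 ≤ 3 * (K ^ 2 * P + N * K ^ 2 * R + Z) := by
    have hterm (i : Fin N) :
        u i ^ 2 ≤ 3 * (K ^ 2 * (∑ j, (y i j - x j) ^ 2) + K ^ 2 * R + ζ i ^ 2) := by
      have h1 := hLip2 i (y i) x
      have h2 := hLip2 i x xs
      rw [hYn] at h1
      rw [hRn, hg0, sub_zero] at h2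
      set w := partialDeriv (f i) i (y i) - partialDeriv (f i) i x with hw
      set v := partialDeriv (f i) i x with hv
      have h3 : u i = -w - v + ζ i := by simp only [hu, hw]; ring
      rw [h3]
      nlinarith [sq_nonneg (w - v), sq_nonneg (w + ζ i), sq_nonneg (v + ζ i)]
    have hsum := Finset.sum_le_sum fun i (_ : i ∈ Finset.univ) => hterm i
    rw [← Finset.mul_sum, Finset.sum_add_distrib, Finset.sum_add_distrib, ← Finset.mul_sum] at hsum
    simp only [Finset.sum_const, Finset.card_univ, Fintype.card_fin, nsmul_eq_mul] at hsum
    linarith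
  have hη : -∑ i, ∑ j, (y i j - x j) / θbar i j * u j ≤ β / (4 * δ) * P + δ * N * ∑ j, u j ^ 2 := by
    have hterm (i j : Fin N) : -((y i j - x j) / θbar i j * u j)
        ≤ β / (4 * δ) * (y i j - x j) ^ 2 + δ * u j ^ 2 := by
      have h1 : (((θbar i j)⁻¹) ^ 2) / (4 * δ) * (y i j - x j) ^ 2
          ≤ β / (4 * δ) * (y i j - x j) ^ 2 := by
        gcongr
        exact hθβ i j
      have h2 : -((y i j - x j) / θbar i j * u j)
          = (((θbar i j)⁻¹) ^ 2) / (4 * δ) * (y i j - x j) ^ 2 + δ * u j ^ 2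
            - ((θbar i j)⁻¹ * (y i j - x j) + 2 * δ * u j) ^ 2 / (4 * δ) := by
        rw [div_eq_mul_inv _ (θbar i j)]; field_simp; ring
      have h3 : 0 ≤ ((θbar i j)⁻¹ * (y i j - x j) + 2 * δ * u j) ^ 2 / (4 * δ) := by positivity
      linarith
    have hsum := Finset.sum_le_sum fun i (_ : i ∈ Finset.univ) =>
      Finset.sum_le_sum fun j (_ : j ∈ Finset.univ) => hterm i j
    simp only [Finset.sum_neg_distrib, Finset.sum_add_distrib, ← Finset.mul_sum, Finset.sum_const,
      Finset.card_univ, Fintype.card_fin, nsmul_eq_mul] at hsum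
    linarith
  have h6 := mul_le_mul_of_nonneg_left hu2 (by positivity : 0 ≤ δ * N)
  have h7 : δ * N * (3 * (N * K ^ 2 * R)) = m / 4 * R := by
    rw [hδ]; field_simp; ring
  linarith

open Filter in
/-- The seeking dynamics are input-to-state stable with respect to the observer error `ζ`,
uniformly in the gain `θ`. -/
theorem exists_gain_seeking {N : ℕ} (hN : 2 ≤ N) {f : Fin N → Profile N → ℝ}
    (hmono : StronglyMonotone f)
    (hLip : ∀ i, ∃ K : ℝ≥0, LipschitzWith K (partialDeriv (f i) i))
    {a : Matrix (Fin N) (Fin N) ℝ} (ha : IsUndirectedConnected a)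
    {θbar : Fin N → Fin N → ℝ} (hθbar : ∀ i j, 0 < θbar i j)
    {xs : Profile N} (hxs : pseudoGradient f xs = 0) :
    ∃ θs C : ℝ, 0 < θs ∧ 0 < C ∧ ∀ θ, θs < θ →
      ∀ (x : ℝ → Profile N) (y : ℝ → Fin N → Profile N) (ζ : ℝ → Fin N → ℝ),
      (∀ᶠ t in atTop, ∀ i, HasDerivAt (fun s => x s i)
        (-partialDeriv (f i) i (y t i) + ζ t i) t) →
      (∀ᶠ t in atTop, ∀ i j, HasDerivAt (fun s => y s i j) (-(θ * θbar i j) *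
        ((∑ k, a i k * (y t i j - y t k j)) + a i j * (y t i j - x t j))) t) →
      ∀ B δ : ℝ, 0 < δ → (∀ᶠ t in atTop, ∑ i, ζ t i ^ 2 ≤ B) →
      ∀ᶠ t in atTop, ∑ i, ∑ j, (y t i j - x t j) ^ 2 + ∑ i, (x t i - xs i) ^ 2 ≤ C * (B + δ) := by
  obtain ⟨m, hm, hmono⟩ := hmono
  obtain ⟨K, hK, hLip⟩ := exists_common_lipschitz hLip
  obtain ⟨C₁, C₂, hC₁, hC₂, hbound⟩ :=
    exists_interconnection_bound (by omega) hK hm hLip hmono (θbar := θbar) hxs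
  obtain ⟨l, hl, hcons⟩ := exists_consensusForm_ge hN ha
  obtain ⟨p, q, hp, hq, hpq⟩ := exists_seekingEnergy_bounds hθbar xs
  set c : ℝ := m / 4 / q with hc
  have hc0 : 0 < c := by positivity
  -- Above this threshold consensus absorbs `C₁ * P` and leaves `m / 4 * P`, matching the
  -- dissipation of `R`; the energy then decays at rate `c` up to `C₂ * B`.
  refine ⟨(C₁ + m / 4) / l, C₂ / c / p, by positivity, by positivity,
    fun θ hθ x y ζ hx hy B δ hδ hζ => ?_⟩
  rw [div_lt_iff₀ hl] at hθ
  -- The weights `1 / (2 * θbar i j)` in the energy cancel the individual gains, leaving the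
  -- symmetric form times `θ`.
  set V' : ℝ → ℝ := fun t => -θ * consensusForm a (fun i j => y t i j - x t j)
    + (∑ i, (x t i - xs i) * (-partialDeriv (f i) i (y t i) + ζ t i)
      - ∑ i, ∑ j, (y t i j - x t j) / θbar i j * (-partialDeriv (f j) j (y t j) + ζ t j)) with hV'
  have hVd : ∀ᶠ t in atTop, HasDerivAt (fun t => seekingEnergy θbar xs (x t) (y t)) (V' t) t := by
    filter_upwards [hx, hy] with t hx hy
    have h1 (i j : Fin N) := ((((hy i j).sub (hx j)).pow 2).div_const (2 * θbar i j))
    have h2 (i : Fin N) := ((((hx i).sub_const (xs i)).pow 2).div_const 2)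
    refine ((HasDerivAt.fun_sum fun i (_ : i ∈ Finset.univ) =>
      HasDerivAt.fun_sum fun j (_ : j ∈ Finset.univ) => h1 i j).add
      (HasDerivAt.fun_sum fun i (_ : i ∈ Finset.univ) => h2 i)).congr_deriv ?_
    simp only [hV', consensusForm]
    rw [Finset.mul_sum, add_sub_left_comm, add_comm, ← Finset.sum_sub_distrib]
    congr 1
    · refine Finset.sum_congr rfl fun i _ => ?_
      simp only [Nat.cast_ofNat, Nat.add_one_sub_one, pow_one]
      ring
    · refine Finset.sum_congr rfl fun i _ => ?_
      rw [Finset.mul_sum, ← Finset.sum_sub_distrib]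
      refine Finset.sum_congr rfl fun j _ => ?_
      have := (hθbar i j).ne'
      simp only [sub_sub_sub_cancel_right, Pi.sub_apply]
      field_simp
      ring
  have hVle : ∀ᶠ t in atTop, V' t ≤ -c * seekingEnergy θbar xs (x t) (y t) + C₂ * B := by
    filter_upwards [hζ] with t hζ
    have h1 := hbound (x t) (y t) (ζ t)
    have h2 := hcons fun i j => y t i j - x t j
    have h3 := (hpq (x t) (y t)).2
    set P := ∑ i, ∑ j, (y t i j - x t j) ^ 2 with hP
    set R := ∑ i, (x t i - xs i) ^ 2 with hR
    have hP0 : 0 ≤ P := by positivity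
    have h4 : c * seekingEnergy θbar xs (x t) (y t) ≤ m / 4 * (P + R) := by
      calc c * seekingEnergy θbar xs (x t) (y t) ≤ c * (q * (P + R)) := by gcongr
        _ = m / 4 * (P + R) := by rw [hc]; field_simp
    have hθ0 : 0 ≤ θ := by
      by_contra! hneg
      nlinarith
    have h5 : θ * (l * P) ≤ θ * consensusForm a (fun i j => y t i j - x t j) := by gcongr
    have h6 : (C₁ + m / 4) * P ≤ θ * l * P := by gcongr
    have h7 : C₂ * ∑ i, ζ t i ^ 2 ≤ C₂ * B := by gcongr
    simp only [hV']
    linarith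
  filter_upwards [eventually_le_of_hasDerivAt_le hc0 (by positivity : 0 < C₂ / c * δ) hVd hVle]
    with t ht
  have h := (hpq (x t) (y t)).1.trans ht
  rw [div_mul_eq_mul_div, le_div_iff₀ hp]
  have e : C₂ * B / c = C₂ / c * B := by ring
  rw [e] at h
  linarith

/-! ### Global existence for the closed loop -/

section Lipschitz

variable {E : Type*} [PseudoMetricSpace E] {g h : E → ℝ}

theorem exists_lipschitzWith_add (hg : ∃ K, LipschitzWith K g) (hh : ∃ K, LipschitzWith K h) :
    ∃ K, LipschitzWith K fun x => g x + h x :=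
  hg.elim fun _ hg => hh.elim fun _ hh => ⟨_, hg.add hh⟩

theorem exists_lipschitzWith_sub (hg : ∃ K, LipschitzWith K g) (hh : ∃ K, LipschitzWith K h) :
    ∃ K, LipschitzWith K fun x => g x - h x :=
  hg.elim fun _ hg => hh.elim fun _ hh => ⟨_, hg.sub hh⟩

theorem exists_lipschitzWith_const_mul (c : ℝ) (hg : ∃ K, LipschitzWith K g) :
    ∃ K, LipschitzWith K fun x => c * g x :=
  hg.elim fun _ hg => ⟨_, (lipschitzWith_smul c).comp hg⟩

theorem exists_lipschitzWith_sum {ι : Type*} (s : Finset ι) {g : ι → E → ℝ}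
    (hg : ∀ i, ∃ K, LipschitzWith K (g i)) : ∃ K, LipschitzWith K fun x => ∑ i ∈ s, g i x := by
  classical
  induction s using Finset.induction_on with
  | empty => exact ⟨0, by simp⟩
  | insert i s hi ih =>
    simp only [Finset.sum_insert hi]
    exact exists_lipschitzWith_add (hg i) ih

theorem exists_lipschitzWith_pi {ι : Type*} [Fintype ι] {g : E → ι → ℝ}
    (hg : ∀ i, ∃ K, LipschitzWith K fun x => g x i) : ∃ K, LipschitzWith K g := by
  choose K hK using hg
  refine ⟨∑ i, K i, LipschitzWith.of_dist_le_mul fun x z => ?_⟩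
  refine (dist_pi_le_iff (by positivity)).2 fun i => ((hK i).dist_le_mul x z).trans ?_
  gcongr
  exact Finset.single_le_sum (f := K) (fun _ _ => zero_le) (Finset.mem_univ i)

end Lipschitz

/-- The closed-loop state with the given coordinates. -/
def stateOfCoords {N : ℕ} (w : Fin N ⊕ (Fin N × Fin N) ⊕ Fin N ⊕ Fin N → ℝ) : State N where
  x := WithLp.toLp 2 fun i => w (.inl i)
  y i := WithLp.toLp 2 fun j => w (.inr (.inl (i, j)))
  xhat := WithLp.toLp 2 fun i => w (.inr (.inr (.inl i)))
  zhat := WithLp.toLp 2 fun i => w (.inr (.inr (.inr i)))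

/-- The closed-loop vector field in coordinates, without the disturbance. -/
noncomputable def closedLoopField {N : ℕ} (f : Fin N → Profile N → ℝ) (a : Matrix (Fin N) (Fin N) ℝ)
    (θbar : Fin N → Fin N → ℝ) (k₁ k₂ : Fin N → ℝ) (θ σ : ℝ) (S : State N) :
    Fin N ⊕ (Fin N × Fin N) ⊕ Fin N ⊕ Fin N → ℝ :=
  Sum.elim (controlInput f S)
    (Sum.elim (fun p => -(θ * θbar p.1 p.2) * ((∑ k, a p.1 k * (S.y p.1 p.2 - S.y k p.2))
        + a p.1 p.2 * (S.y p.1 p.2 - S.x p.2)))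
      (Sum.elim (fun i => controlInput f S i + S.zhat i + σ * k₁ i * (S.x i - S.xhat i))
        (fun i => σ ^ 2 * k₂ i * (S.x i - S.xhat i))))

theorem exists_lipschitzWith_closedLoopField {N : ℕ} {f : Fin N → Profile N → ℝ}
    (hLip : ∀ i, ∃ K : ℝ≥0, LipschitzWith K (partialDeriv (f i) i))
    (a : Matrix (Fin N) (Fin N) ℝ) (θbar : Fin N → Fin N → ℝ) (k₁ k₂ : Fin N → ℝ) (θ σ : ℝ) :
    ∃ K, LipschitzWith K fun w => closedLoopField f a θbar k₁ k₂ θ σ (stateOfCoords w) := by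
  have coord (k : Fin N ⊕ (Fin N × Fin N) ⊕ Fin N ⊕ Fin N) :
      ∃ K, LipschitzWith K fun w : Fin N ⊕ (Fin N × Fin N) ⊕ Fin N ⊕ Fin N → ℝ => w k :=
    ⟨1, LipschitzWith.eval k⟩
  have input (i : Fin N) : ∃ K, LipschitzWith K fun w => controlInput f (stateOfCoords w) i := by
    obtain ⟨K, hK⟩ := hLip i
    obtain ⟨K', hK'⟩ := exists_lipschitzWith_pi
      (g := fun (w : Fin N ⊕ (Fin N × Fin N) ⊕ Fin N ⊕ Fin N → ℝ) j => w (.inr (.inl (i, j))))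
      fun j => coord _
    exact exists_lipschitzWith_sub
      ⟨_, (hK.comp ((PiLp.lipschitzWith_toLp 2 fun _ : Fin N => ℝ).comp hK')).neg⟩ (coord _)
  refine exists_lipschitzWith_pi ?_
  rintro (i | p | i | i)
  · exact input i
  · exact exists_lipschitzWith_const_mul _ (exists_lipschitzWith_add
      (exists_lipschitzWith_sum _ fun k => exists_lipschitzWith_const_mul _
        (exists_lipschitzWith_sub (coord _) (coord _)))
      (exists_lipschitzWith_const_mul _ (exists_lipschitzWith_sub (coord _) (coord _))))
  · exact exists_lipschitzWith_add (exists_lipschitzWith_add (input i) (coord _))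
      (exists_lipschitzWith_const_mul _ (exists_lipschitzWith_sub (coord _) (coord _)))
  · exact exists_lipschitzWith_const_mul _ (exists_lipschitzWith_sub (coord _) (coord _))

/-- The disturbance enters as an additive function of time, so it does not affect the Lipschitz
constant in the state. -/
theorem exists_isClosedLoopSolution {N : ℕ} {f : Fin N → Profile N → ℝ}
    (hLip : ∀ i, ∃ K : ℝ≥0, LipschitzWith K (partialDeriv (f i) i))
    (a : Matrix (Fin N) (Fin N) ℝ) (θbar : Fin N → Fin N → ℝ) (k₁ k₂ : Fin N → ℝ)
    {d : Fin N → ℝ → ℝ} {t₀ : ℝ} (hd : ∀ i, ContinuousOn (d i) (Set.Ici t₀)) (θ σ : ℝ)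
    (S₀ : State N) :
    ∃ S : ℝ → State N, S t₀ = S₀ ∧ IsClosedLoopSolution f a θbar k₁ k₂ d t₀ θ σ S := by
  obtain ⟨K, hK⟩ := exists_lipschitzWith_closedLoopField hLip a θbar k₁ k₂ θ σ
  let D : ℝ → Fin N ⊕ (Fin N × Fin N) ⊕ Fin N ⊕ Fin N → ℝ :=
    fun t => Sum.elim (fun i => d i t) 0
  have hD : ContinuousOn D (Set.Ici t₀) := by
    refine continuousOn_pi.2 ?_
    rintro (i | p)
    · exact hd i
    · exact continuousOn_const
  obtain ⟨w, hw₀, hw⟩ := exists_solution_Ici_of_lipschitzWith (t₀ := t₀) (K := K)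
    (F := fun t w => closedLoopField f a θbar k₁ k₂ θ σ (stateOfCoords w) + D t)
    (fun t _ => LipschitzWith.of_dist_le_mul fun x z => by
      simpa only [dist_add_right] using hK.dist_le_mul x z)
    (fun x => continuousOn_const.add hD)
    (Sum.elim (fun i => S₀.x i) (Sum.elim (fun p => S₀.y p.1 p.2)
      (Sum.elim (fun i => S₀.xhat i) (fun i => S₀.zhat i))))
  have hw' (k) (t : ℝ) (ht : t₀ ≤ t) := hasDerivWithinAt_pi.1 (hw t ht) k
  refine ⟨fun t => stateOfCoords (w t), by beta_reduce; rw [hw₀]; rfl, fun i t ht => hw' (.inl i) t ht,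
    fun i j t ht => ?_, fun i t ht => ?_, fun i t ht => ?_⟩
  · exact (hw' (.inr (.inl (i, j))) t ht).congr_deriv (add_zero _)
  · exact (hw' (.inr (.inr (.inl i))) t ht).congr_deriv (add_zero _)
  · exact (hw' (.inr (.inr (.inr i))) t ht).congr_deriv (add_zero _)

/-! ### Combining observer and seeking dynamics -/

theorem totalError_norm_sq {N : ℕ} (xs : Profile N) (d : Fin N → ℝ → ℝ) (t : ℝ) (S : State N) :
    ‖totalError xs d t S‖ ^ 2 = ∑ i, (S.x i - S.xhat i) ^ 2 + (∑ i, (d i t - S.zhat i) ^ 2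
      + (∑ i, ∑ j, (S.y i j - S.x j) ^ 2 + ∑ i, (S.x i - xs i) ^ 2)) := by
  simp [EuclideanSpace.norm_sq_eq, totalError, Fintype.sum_prod_type]

open Filter in
/-- For a large observer gain, both observer errors of every player are ultimately small. -/
theorem exists_gain_observers {N : ℕ} {k₁ k₂ : Fin N → ℝ} (hk₁ : ∀ i, 0 < k₁ i)
    (hk₂ : ∀ i, 0 < k₂ i) {t₀ : ℝ} {d : Fin N → ℝ → ℝ} (hd : IsAdmissibleDisturbance t₀ d)
    (f : Fin N → Profile N → ℝ) (a : Matrix (Fin N) (Fin N) ℝ) (θbar : Fin N → Fin N → ℝ)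
    {ε : ℝ} (hε : 0 < ε) :
    ∃ σs : ℝ, 0 < σs ∧ ∀ θ σ : ℝ, σs < σ → ∀ S : ℝ → State N,
      IsClosedLoopSolution f a θbar k₁ k₂ d t₀ θ σ S →
      ∀ᶠ t in atTop, ∀ i, ((S t).x i - (S t).xhat i) ^ 2 ≤ ε ^ 2 ∧
        (d i t - (S t).zhat i) ^ 2 ≤ ε ^ 2 := by
  choose D hD using hd.bounded
  choose σs hσs hobs using fun i => exists_gain_observer (D := D i) (hk₁ i) (hk₂ i) hε
  -- The sum exceeds each player's threshold; the 1 keeps it positive when there are no players.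
  refine ⟨∑ i, σs i + 1, by
    have := Finset.sum_nonneg fun i (_ : i ∈ Finset.univ) => (hσs i).le
    linarith, fun θ σ hσ S hS => ?_⟩
  refine eventually_all.2 fun i => ?_
  have hi : σs i < σ := by
    have := Finset.single_le_sum (f := σs) (fun i _ => (hσs i).le) (Finset.mem_univ i)
    linarith
  -- The input `u_i` cancels in `ζ₁`, so neither `θ` nor the costs influence the threshold.
  refine hobs i σ hi (fun t => (S t).x i - (S t).xhat i) (fun t => d i t - (S t).zhat i)
    (fun t => derivWithin (d i) (Set.Ici t₀) t) ?_ ?_ ?_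
  · filter_upwards [eventually_gt_atTop t₀] with t ht
    have hnhds := Ici_mem_nhds ht
    refine (((hS.x_deriv i t ht.le).hasDerivAt hnhds).sub
      ((hS.xhat_deriv i t ht.le).hasDerivAt hnhds)).congr_deriv ?_
    ring
  · filter_upwards [eventually_gt_atTop t₀] with t ht
    have hnhds := Ici_mem_nhds ht
    exact (((hd.contDiffOn i).differentiableOn one_ne_zero t ht.le).hasDerivWithinAt.hasDerivAt
      hnhds).sub ((hS.zhat_deriv i t ht.le).hasDerivAt hnhds)
  · filter_upwards [eventually_ge_atTop t₀] with t ht using hD i t ht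

open Filter in
/-- Ultimate boundedness of the total error, with an arbitrarily small bound. -/
theorem exists_gains {N : ℕ} (hN : 2 ≤ N) {f : Fin N → Profile N → ℝ}
    (hmono : StronglyMonotone f)
    (hLip : ∀ i, ∃ K : ℝ≥0, LipschitzWith K (partialDeriv (f i) i))
    {a : Matrix (Fin N) (Fin N) ℝ} (ha : IsUndirectedConnected a)
    {t₀ : ℝ} {d : Fin N → ℝ → ℝ} (hd : IsAdmissibleDisturbance t₀ d)
    {θbar : Fin N → Fin N → ℝ} (hθbar : ∀ i j, 0 < θbar i j)
    {k₁ k₂ : Fin N → ℝ} (hk₁ : ∀ i, 0 < k₁ i) (hk₂ : ∀ i, 0 < k₂ i)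
    {xs : Profile N} (hxs : pseudoGradient f xs = 0) :
    ∃ θs : ℝ, 0 < θs ∧ ∀ v : ℝ, 0 < v → ∃ σs : ℝ, 0 < σs ∧ ∀ θ, θs < θ → ∀ σ, σs < σ →
      ∀ S : ℝ → State N, IsClosedLoopSolution f a θbar k₁ k₂ d t₀ θ σ S →
        ∀ᶠ t in atTop, ‖totalError xs d t (S t)‖ ≤ v := by
  obtain ⟨θs, C, hθs, hC, hseek⟩ := exists_gain_seeking hN hmono hLip ha hθbar hxs
  refine ⟨θs, hθs, fun v hv => ?_⟩
  -- The two observer errors contribute `N * ε ^ 2` each, and the seeking errors `C * (N + 1) * ε ^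
  -- 2`, from `B = N * ε ^ 2` and slack `ε ^ 2`.
  obtain ⟨ε, hε, hεv⟩ : ∃ ε : ℝ, 0 < ε ∧ (2 * N + C * (N + 1)) * ε ^ 2 = v ^ 2 := by
    have h0 : 0 < 2 * N + C * (N + 1) := by positivity
    refine ⟨v / √(2 * N + C * (N + 1)), by positivity, ?_⟩
    rw [div_pow, Real.sq_sqrt h0.le]
    field_simp
  obtain ⟨σs, hσs, hobs⟩ := exists_gain_observers hk₁ hk₂ hd f a θbar hε
  refine ⟨σs, hσs, fun θ hθ σ hσ S hS => ?_⟩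
  have hζ := hobs θ σ hσ S hS
  have hηξ := hseek θ hθ (fun t => (S t).x) (fun t => (S t).y) (fun t i => d i t - (S t).zhat i)
    (by
      filter_upwards [eventually_gt_atTop t₀] with t ht i
      refine ((hS.x_deriv i t ht.le).hasDerivAt (Ici_mem_nhds ht)).congr_deriv ?_
      rw [controlInput]
      ring)
    (by
      filter_upwards [eventually_gt_atTop t₀] with t ht i j
      exact (hS.y_deriv i j t ht.le).hasDerivAt (Ici_mem_nhds ht))
    (N * ε ^ 2) (ε ^ 2) (by positivity)
    (by
      filter_upwards [hζ] with t ht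
      simpa using Finset.sum_le_sum fun i (_ : i ∈ Finset.univ) => (ht i).2)
  filter_upwards [hζ, hηξ] with t h₁ h₂
  refine abs_le_of_sq_le_sq' ?_ hv.le |>.2
  rw [totalError_norm_sq, ← hεv]
  have h₃ : ∑ i, ((S t).x i - (S t).xhat i) ^ 2 ≤ N * ε ^ 2 := by
    simpa using Finset.sum_le_sum fun i (_ : i ∈ Finset.univ) => (h₁ i).1
  have h₄ : ∑ i, (d i t - (S t).zhat i) ^ 2 ≤ N * ε ^ 2 := by
    simpa using Finset.sum_le_sum fun i (_ : i ∈ Finset.univ) => (h₁ i).2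
  linarith

end NashSeeking

theorem corollary1 (N : ℕ) (hN : 2 ≤ N)
    (f : Fin N → NashSeeking.Profile N → ℝ)
    (hf : ∀ i, ContDiff ℝ 2 (f i))
    (hmono : NashSeeking.StronglyMonotone f)
    (hLip : ∀ i, ∃ K : ℝ≥0, LipschitzWith K (NashSeeking.partialDeriv (f i) i))
    (a : Matrix (Fin N) (Fin N) ℝ) (ha : NashSeeking.IsUndirectedConnected a)
    (t₀ : ℝ) (d : Fin N → ℝ → ℝ) (hd : NashSeeking.IsAdmissibleDisturbance t₀ d)
    (θbar : Fin N → Fin N → ℝ) (hθbar : ∀ i j, 0 < θbar i j)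
    (k₁ k₂ : Fin N → ℝ) (hk₁ : ∀ i, 0 < k₁ i) (hk₂ : ∀ i, 0 < k₂ i) :
    (∃! xs : NashSeeking.Profile N, NashSeeking.IsNashEquilibrium f xs) ∧
    ∀ xs : NashSeeking.Profile N, NashSeeking.IsNashEquilibrium f xs →
      ∃ θs : ℝ, 0 < θs ∧ ∀ v₁ : ℝ, 0 < v₁ → ∃ σs : ℝ, 0 < σs ∧
        ∀ θ : ℝ, θs < θ → ∀ σ : ℝ, σs < σ →
          (∀ S₀ : NashSeeking.State N, ∃ S : ℝ → NashSeeking.State N, S t₀ = S₀ ∧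
            NashSeeking.IsClosedLoopSolution f a θbar k₁ k₂ d t₀ θ σ S) ∧
          ∀ S : ℝ → NashSeeking.State N,
            NashSeeking.IsClosedLoopSolution f a θbar k₁ k₂ d t₀ θ σ S →
            ∃ T : ℝ, t₀ ≤ T ∧ ∀ t : ℝ, T ≤ t →
              ‖NashSeeking.totalError xs d t (S t)‖ ≤ v₁ := by
  have hf' (i) : Differentiable ℝ (f i) := (hf i).differentiable two_ne_zero
  refine ⟨NashSeeking.existsUnique_isNashEquilibrium hf' hmono hLip, fun xs hxs => ?_⟩
  obtain ⟨θs, hθs, h⟩ := NashSeeking.exists_gains hN hmono hLip ha hd hθbar hk₁ hk₂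
    ((NashSeeking.isNashEquilibrium_iff hf' hmono xs).1 hxs)
  refine ⟨θs, hθs, fun v₁ hv₁ => ?_⟩
  obtain ⟨σs, hσs, h⟩ := h v₁ hv₁
  refine ⟨σs, hσs, fun θ hθ σ hσ => ⟨fun S₀ => ?_, fun S hS => ?_⟩⟩
  · exact NashSeeking.exists_isClosedLoopSolution hLip a θbar k₁ k₂
      (fun i => (hd.contDiffOn i).continuousOn) θ σ S₀
  · obtain ⟨T, hT⟩ := Filter.eventually_atTop.1 (h θ hθ σ hσ S hS)
    exact ⟨max T t₀, le_max_right _ _, fun t ht => hT t ((le_max_left _ _).trans ht)⟩
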